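/- Let $H$ be a complex Hilbert space and let $V$ be a closed isometric operator in $H$, i.e. a closed linear operator with domain $D(V)\subseteq H$ and range $R(V)\subseteq H$ such that $\|Vh\|=\|h\|$ for all $h\in D(V)$. Put $N_0=H\ominus D(V)$ and $N_\infty=H\ominus R(V)$, and for a bounded linear operator $C:N_0\to N_\infty$ let $V\oplus C$ be the operator on $H=D(V)\oplus N_0$ which equals $V$ on $D(V)$ and $C$ on $N_0$. Let $\mathbb D=\{|z|<1\}$, $\mathbb D_e=\{|z|>1\}$, $\mathbb T=\{|z|=1\}$. Let $\mathbf R_z$ be an arbitrary generalized resolvent of $V$, that is, $\mathbf R_z h=P^{\widetilde H}_H(E_{\widetilde H}-zU)^{-1}h$ for $h\in H$, $|z|\neq 1$, where $U\supseteq V$ is a unitary operator in a Hilbert space $\widetilde H\supseteq H$ and $P^{\widetilde H}_H$ is the orthogonal projection of $\widetilde H$ onto $H$. Let $F$ be the function corresponding to $\mathbf R_z$ by Chumakin's formula: $F\in\mathcal S(N_0;N_\infty)$, i.e. $F$ is an analytic function in $\mathbb D$ whose values are linear contractions from $N_0$ into $N_\infty$, and $$\mathbf R_z=\bigl[E_H-z\,(V\oplus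 F(z))\bigr]^{-1},\qquad z\in\mathbb D.$$ Let $\Delta$ be an open arc of $\mathbb T$. Then $\mathbf R_z$ has an analytic continuation (as a function with values in the bounded operators on $H$) to $\mathbb D\cup\mathbb D_e\cup\Delta$ if and only if the following conditions are satisfied: 1) $F$ has an extension to $\mathbb D\cup\Delta$, with values in the bounded linear operators from $N_0$ to $N_\infty$, which is continuous in the uniform operator topology; 2) for all $\lambda\in\Delta$, the extended $F(\lambda)$ maps $N_0$ isometrically onto the whole $N_\infty$; 3) for all $\lambda\in\Delta$, the operator $\bigl(E_H-\lambda\,(V\oplus F(\lambda))\bigr)^{-1}$ exists and is defined on the whole $H$. -/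

import Mathlib

namespace IsometricGaps

/-- A closed isometric operator `V` in the Hilbert space `H`: a linear operator with domain
`D(V) ⊆ H` (not assumed dense), with closed graph, preserving the norm. -/
structure ClosedIsometricOperator (H : Type*) [NormedAddCommGroup H] [InnerProductSpace ℂ H] where
  /-- the underlying partially defined linear operator -/
  op : H →ₗ.[ℂ] H
  isClosed : op.IsClosed
  norm_map : ∀ x : op.domain, ‖op x‖ = ‖x‖

namespace ClosedIsometricOperator

variable {H : Type*} [NormedAddCommGroup H] [InnerProductSpace ℂ H]

/-- `V` as a linear isometry defined on its domain. -/
def isom (V : ClosedIsometricOperator H) : V.op.domain →ₗᵢ[ℂ] H where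
  toLinearMap := V.op.toFun
  norm_map' := V.norm_map

/-- The domain of a closed isometric operator in a Hilbert space is complete. -/
theorem completeSpace_domain [CompleteSpace H] (V : ClosedIsometricOperator H) :
    CompleteSpace V.op.domain := by
  have hc : IsClosed (V.op.domain : Set H) := by
    refine IsSeqClosed.isClosed ?_
    intro u x hu hx
    have hcau : CauchySeq (fun n => V.op ⟨u n, hu n⟩) := by
      have h1 : CauchySeq (fun n => (⟨u n, hu n⟩ : V.op.domain)) :=
        by
        have h0 := Metric.cauchySeq_iff.1 hx.cauchySeq
        exact Metric.cauchySeq_iff.2 h0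
      exact h1.map V.isom.isometry.uniformContinuous
    obtain ⟨y, hy⟩ := cauchySeq_tendsto_of_complete hcau
    have hg : (x, y) ∈ V.op.graph := by
      have hcl : IsClosed (V.op.graph : Set (H × H)) := V.isClosed
      refine hcl.mem_of_tendsto (hx.prodMk_nhds hy) (Filter.Eventually.of_forall fun n => ?_)
      exact V.op.mem_graph ⟨u n, hu n⟩
    obtain ⟨z, hz, -⟩ := (LinearPMap.mem_graph_iff _).1 hg
    have hz' : (z : H) = x := hz
    exact hz' ▸ z.2
  exact hc.completeSpace_coe

instance [CompleteSpace H] (V : ClosedIsometricOperator H) : CompleteSpace V.op.domain :=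
  V.completeSpace_domain

/-- The defect subspace `N_0 = H ⊖ D(V)`. -/
noncomputable abbrev defectZero (V : ClosedIsometricOperator H) : Submodule ℂ H :=
  V.op.domainᗮ

/-- The defect subspace `N_∞ = H ⊖ R(V)`. -/
noncomputable abbrev defectInfty (V : ClosedIsometricOperator H) : Submodule ℂ H :=
  (LinearMap.range V.op.toFun)ᗮ

/-- The orthogonal sum `V ⊕ C` for a bounded operator `C : N_0 → N_∞`: the bounded operator on
`H = D(V) ⊕ N_0` that acts as `V` on `D(V)` and as `C` on `N_0`. -/
noncomputable def oplus [CompleteSpace H] (V : ClosedIsometricOperator H)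
    (C : V.defectZero →L[ℂ] V.defectInfty) : H →L[ℂ] H :=
  V.isom.toContinuousLinearMap ∘L V.op.domain.orthogonalProjectionOnto +
    V.defectInfty.subtypeL ∘L C ∘L V.defectZero.orthogonalProjectionOnto

end ClosedIsometricOperator

/-- The class `𝒮(H₁; H₂)`: functions analytic in the open unit disc whose values are
linear contractions `H₁ → H₂` (values outside the disc are irrelevant). -/
structure IsSchurFunction {H₁ H₂ : Type*} [NormedAddCommGroup H₁] [NormedSpace ℂ H₁]
    [NormedAddCommGroup H₂] [NormedSpace ℂ H₂] (F : ℂ → H₁ →L[ℂ] H₂) : Prop where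
  analytic : AnalyticOnNhd ℂ F {z : ℂ | ‖z‖ < 1}
  contraction : ∀ z : ℂ, ‖z‖ < 1 → ∀ x : H₁, ‖F z x‖ ≤ ‖x‖

section GeneralizedResolvent

variable {H : Type*} [NormedAddCommGroup H] [InnerProductSpace ℂ H] [CompleteSpace H]
  {K : Type*} [NormedAddCommGroup K] [InnerProductSpace ℂ K] [CompleteSpace K]

/-- The unitary operator `U` in `K`, where `H` is regarded as a subspace of `K` by means of the
isometric embedding `ι`, extends `V`. -/
def IsUnitaryExtension (V : ClosedIsometricOperator H) (ι : H →ₗᵢ[ℂ] K) (U : K ≃ₗᵢ[ℂ] K) : Prop :=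
  ∀ x : V.op.domain, U (ι (x : H)) = ι (V.op x)

/-- The generalized resolvent `R_z h = P (E - z U)⁻¹ h`, `h ∈ H`, where `P` is the orthogonal
projection of `K` onto `H`; the adjoint of the embedding `ι` of `H` is `P` seen as a map into `H`.
It is used for `|z| ≠ 1` only, where `E - z U` is boundedly invertible. -/
noncomputable def generalizedResolvent (ι : H →ₗᵢ[ℂ] K) (U : K ≃ₗᵢ[ℂ] K) (z : ℂ) : H →L[ℂ] H :=
  ContinuousLinearMap.adjoint ι.toContinuousLinearMap ∘L
    Ring.inverse (1 - z • (U.toContinuousLinearEquiv : K →L[ℂ] K)) ∘L ι.toContinuousLinearMap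

/-- `F` corresponds to the operator function `R` by Chumakin's formula: `F ∈ 𝒮(N_0; N_∞)` and
`R_z = [E - z (V ⊕ F(z))]⁻¹` (two-sided inverse) for all `z` in the open unit disc. -/
structure IsChumakinParameter (V : ClosedIsometricOperator H) (R : ℂ → H →L[ℂ] H)
    (F : ℂ → V.defectZero →L[ℂ] V.defectInfty) : Prop where
  schur : IsSchurFunction F
  mul_eq_one : ∀ z : ℂ, ‖z‖ < 1 → R z * (1 - z • V.oplus (F z)) = 1
  eq_one_mul : ∀ z : ℂ, ‖z‖ < 1 → (1 - z • V.oplus (F z)) * R z = 1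

end GeneralizedResolvent

/-- An open arc of the unit circle: the image of a nonempty open interval of the real line under
`t ↦ e^{it}` (equivalently, a nonempty connected relatively open subset of the circle). -/
def IsOpenArc (Δ : Set ℂ) : Prop :=
  ∃ a b : ℝ, a < b ∧ Δ = (fun t : ℝ => Complex.exp (t * Complex.I)) '' Set.Ioo a b

/-- The function `R`, considered on `{|z| ≠ 1}`, has an analytic continuation (as a function with
values in a normed space) to `{|z| < 1} ∪ {|z| > 1} ∪ Δ`. -/
def HasAnalyticContinuation {E : Type*} [NormedAddCommGroup E] [NormedSpace ℂ E]
    (R : ℂ → E) (Δ : Set ℂ) : Prop :=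
  ∃ T : ℂ → E, AnalyticOnNhd ℂ T ({z : ℂ | ‖z‖ < 1} ∪ {z : ℂ | 1 < ‖z‖} ∪ Δ) ∧
    ∀ z : ℂ, ‖z‖ ≠ 1 → T z = R z

end IsometricGaps

/-! A generalized resolvent satisfies `R(z) + R(1/z̄)* = 1`. At a point of the circle across which
it continues, the continuation `T` therefore satisfies `T + T* = 1`; then `2T - 1` is skew-adjoint,
so `T` is invertible and `z⁻¹ (1 - T⁻¹)` is unitary. Inside the disc this last expression is
`V ⊕ F(z)`, and the operators of the form `V ⊕ C` are a closed set, so on the circle it is some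
`V ⊕ G(z)`, whose unitarity says that `G(z)` maps `N_0` isometrically onto `N_∞`. Conversely, given
such a `G`, the boundary values `L = (1 - z (V ⊕ G(z)))⁻¹` satisfy `L + L* = 1`, so the resolvent
inside the disc and its reflection outside glue to a continuous function, which is analytic by
Painlevé's theorem on removing the circle. -/

namespace IsometricGaps

open Complex Set Filter Topology Metric

section Painleve

variable {E : Type*} [NormedAddCommGroup E] [NormedSpace ℂ E] {f : ℂ → E} {S : Set ℂ}

theorem rectangleIntegral_eq_add_of_mem_uIcc_im {z w : ℂ} {m : ℝ}
    (hc : ContinuousOn f (Rectangle z w)) (hm : m ∈ uIcc z.im w.im) :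
    wedgeIntegral z w f + wedgeIntegral w z f =
      (wedgeIntegral z ⟨w.re, m⟩ f + wedgeIntegral ⟨w.re, m⟩ z f) +
        (wedgeIntegral ⟨z.re, m⟩ w f + wedgeIntegral w ⟨z.re, m⟩ f) := by
  have integrable : ∀ a ∈ uIcc z.re w.re, ∀ s t : ℝ, uIcc s t ⊆ uIcc z.im w.im →
      IntervalIntegrable (fun y : ℝ => f (a + y * I)) MeasureTheory.volume s t := by
    intro a ha s t hst
    refine ContinuousOn.intervalIntegrable (hc.comp (by fun_prop) fun y hy => ⟨?_, ?_⟩)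
    · simpa using ha
    · simpa using hst hy
  have lower : uIcc z.im m ⊆ uIcc z.im w.im := uIcc_subset_uIcc left_mem_uIcc hm
  have upper : uIcc m w.im ⊆ uIcc z.im w.im := uIcc_subset_uIcc hm right_mem_uIcc
  simp only [wedgeIntegral_add_wedgeIntegral_eq]
  rw [← intervalIntegral.integral_add_adjacent_intervals
      (integrable w.re right_mem_uIcc _ _ lower) (integrable w.re right_mem_uIcc _ _ upper),
    ← intervalIntegral.integral_add_adjacent_intervals
      (integrable z.re left_mem_uIcc _ _ lower) (integrable z.re left_mem_uIcc _ _ upper),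
    smul_add, smul_add]
  abel

theorem rectangleIntegral_eq_zero_of_zero_notMem_Ioo_im {z w : ℂ}
    (hc : ContinuousOn f (Rectangle z w))
    (hd : ∀ v ∈ Rectangle z w, v.im ≠ 0 → DifferentiableAt ℂ f v)
    (h0 : (0 : ℝ) ∉ Ioo (min z.im w.im) (max z.im w.im)) :
    wedgeIntegral z w f + wedgeIntegral w z f = 0 := by
  rw [wedgeIntegral_add_wedgeIntegral_eq]
  refine integral_boundary_rect_eq_zero_of_continuousOn_of_differentiableOn f z w hc ?_
  rintro v ⟨hre, him⟩
  refine (hd v ⟨Ioo_subset_Icc_self hre, Ioo_subset_Icc_self him⟩ ?_).differentiableWithinAt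
  intro hv
  exact h0 (hv ▸ him)

theorem isConservativeOn_of_differentiableAt_of_im_ne_zero
    (hc : ContinuousOn f S) (hd : ∀ z ∈ S, z.im ≠ 0 → DifferentiableAt ℂ f z) :
    IsConservativeOn f S := by
  intro z w hzw
  -- The point of `[[z.im, w.im]]` closest to `0`: cutting at this height leaves two rectangles
  -- whose interiors miss the real axis, wherever the original rectangle lies.
  obtain ⟨m, hm, hlower, hupper⟩ : ∃ m ∈ uIcc z.im w.im,
      (0 : ℝ) ∉ Ioo (min z.im m) (max z.im m) ∧ (0 : ℝ) ∉ Ioo (min m w.im) (max m w.im) := by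
    refine ⟨max (min z.im w.im) (min 0 (max z.im w.im)),
      ⟨le_max_left _ _, max_le min_le_max (min_le_right _ _)⟩, ?_, ?_⟩ <;>
    · simp only [mem_Ioo]
      grind
  have lower : Rectangle z ⟨w.re, m⟩ ⊆ Rectangle z w :=
    reProdIm_subset_iff'.2 (Or.inl ⟨subset_rfl, uIcc_subset_uIcc left_mem_uIcc hm⟩)
  have upper : Rectangle ⟨z.re, m⟩ w ⊆ Rectangle z w :=
    reProdIm_subset_iff'.2 (Or.inl ⟨subset_rfl, uIcc_subset_uIcc hm right_mem_uIcc⟩)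
  have hc' := hc.mono hzw
  have hd' := fun v hv => hd v (hzw hv)
  rw [← add_eq_zero_iff_eq_neg, rectangleIntegral_eq_add_of_mem_uIcc_im hc' hm,
    rectangleIntegral_eq_zero_of_zero_notMem_Ioo_im (hc'.mono lower)
      (fun v hv => hd' v (lower hv)) hlower,
    rectangleIntegral_eq_zero_of_zero_notMem_Ioo_im (hc'.mono upper)
      (fun v hv => hd' v (upper hv)) hupper, add_zero]

variable [CompleteSpace E]

theorem analyticOnNhd_of_differentiableAt_of_im_ne_zero (hS : IsOpen S) (hc : ContinuousOn f S)
    (hd : ∀ z ∈ S, z.im ≠ 0 → DifferentiableAt ℂ f z) : AnalyticOnNhd ℂ f S :=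
  ((isConservativeOn_and_continuousOn_iff_isDifferentiableOn hS).1
    ⟨isConservativeOn_of_differentiableAt_of_im_ne_zero hc hd, hc⟩).analyticOnNhd hS

theorem analyticOnNhd_of_differentiableAt_of_norm_ne_one (hS : IsOpen S) (hc : ContinuousOn f S)
    (hd : ∀ z ∈ S, ‖z‖ ≠ 1 → DifferentiableAt ℂ f z) : AnalyticOnNhd ℂ f S := by
  intro z hz
  by_cases hz1 : ‖z‖ = 1
  swap
  · refine analyticAt_iff_eventually_differentiableAt.2 ?_
    filter_upwards [hS.mem_nhds hz,
      (isOpen_ne_fun continuous_norm continuous_const).mem_nhds hz1] with w hw hw1 using hd w hw hw1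
  -- `w ↦ exp (I * w)` straightens the circle to the real axis.
  have hexp : Differentiable ℂ fun w : ℂ => exp (I * w) := by fun_prop
  have hderiv (w : ℂ) : deriv (fun w : ℂ => exp (I * w)) w ≠ 0 := by
    rw [(((hasDerivAt_id' w).const_mul I).cexp).deriv]
    simp [exp_ne_zero]
  have hlift : AnalyticOnNhd ℂ (f ∘ fun w => exp (I * w)) ((fun w => exp (I * w)) ⁻¹' S) := by
    refine analyticOnNhd_of_differentiableAt_of_im_ne_zero (hS.preimage hexp.continuous)
      (hc.comp hexp.continuous.continuousOn fun _ hw => hw) fun w hw hw0 => ?_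
    refine (hd _ hw ?_).comp w hexp.differentiableAt
    simpa [norm_exp] using hw0
  obtain ⟨t, rfl⟩ : ∃ t : ℂ, exp (I * t) = z :=
    ⟨z.arg, by simpa [hz1, mul_comm] using norm_mul_exp_arg_mul_I z⟩
  exact (analyticAt_comp_iff_of_deriv_ne_zero (hexp.analyticAt t) (hderiv t)).1 (hlift t hz)

end Painleve

section UnitCircle

/-- The open unit disc as a set, written as in `HasAnalyticContinuation`. -/
abbrev unitDisc : Set ℂ :=
  {z : ℂ | ‖z‖ < 1}

/-- The exterior of the closed unit disc, written as in `HasAnalyticContinuation`. -/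
abbrev unitDiscExterior : Set ℂ :=
  {z : ℂ | 1 < ‖z‖}

theorem isOpen_unitDisc : IsOpen unitDisc :=
  isOpen_lt continuous_norm continuous_const

theorem isOpen_unitDiscExterior : IsOpen unitDiscExterior :=
  isOpen_lt continuous_const continuous_norm

theorem isOpen_disc_union_exterior_union_inter_sphere {O : Set ℂ} (hO : IsOpen O) :
    IsOpen (unitDisc ∪ unitDiscExterior ∪ O ∩ sphere 0 1) := by
  convert (isOpen_unitDisc.union isOpen_unitDiscExterior).union hO using 1
  ext z
  rcases lt_trichotomy ‖z‖ 1 with h | h | h <;> simp [h]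

theorem nhdsWithin_unitDisc_neBot {z : ℂ} (hz : ‖z‖ = 1) : (𝓝[unitDisc] z).NeBot := by
  rw [show unitDisc = ball 0 1 from (ball_zero_eq 1).symm, ← mem_closure_iff_nhdsWithin_neBot,
    closure_ball _ one_ne_zero]
  simp [hz]

theorem IsOpenArc.exists_isOpen_inter_sphere {Δ : Set ℂ} (hΔ : IsOpenArc Δ) :
    ∃ O : Set ℂ, IsOpen O ∧ Δ = O ∩ sphere 0 1 := by
  obtain ⟨a, b, -, rfl⟩ := hΔ
  refine ⟨exp '' (im ⁻¹' Ioo a b), isOpenMap_exp _ (isOpen_Ioo.preimage continuous_im), ?_⟩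
  apply Subset.antisymm
  · rintro _ ⟨t, ht, rfl⟩
    exact ⟨⟨t * I, by simpa using ht, rfl⟩, by simp [norm_exp_ofReal_mul_I]⟩
  · rintro _ ⟨⟨w, hw, rfl⟩, hw1⟩
    have hre : w.re = 0 := by simpa [norm_exp] using hw1
    refine ⟨w.im, hw, congrArg exp ?_⟩
    exact Complex.ext (by simp [hre]) (by simp)

/-- The reflection `z ↦ 1 / z̄` in the unit circle, with the junk value `0` at `0`. -/
noncomputable def circleReflection (z : ℂ) : ℂ :=
  (star z)⁻¹

theorem norm_circleReflection (z : ℂ) : ‖circleReflection z‖ = ‖z‖⁻¹ := by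
  rw [circleReflection, norm_inv, norm_star]

theorem circleReflection_eq_self {z : ℂ} (hz : ‖z‖ = 1) : circleReflection z = z := by
  rw [circleReflection, inv_eq_conj (by rwa [norm_star]), RCLike.star_def, conj_conj]

theorem continuousAt_circleReflection {z : ℂ} (hz : z ≠ 0) : ContinuousAt circleReflection z :=
  continuous_star.continuousAt.inv₀ (star_ne_zero.2 hz)

end UnitCircle

section Reflection

variable {E : Type*} [NormedAddCommGroup E] [StarAddMonoid E] {R L T : ℂ → E} {c : E}

/-- The symmetry `R(z) + R(1/z̄)* = c` of a function `R` given off the unit circle. A generalized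
resolvent has it with `c = 1`, which ties its values outside the disc to those inside. The point
`0` is left out because its reflection is `∞`. -/
def HasReflectionSum (R : ℂ → E) (c : E) : Prop :=
  ∀ z : ℂ, ‖z‖ ≠ 1 → z ≠ 0 → R z + star (R (circleReflection z)) = c

theorem HasReflectionSum.congr (hR : HasReflectionSum R c) (hTR : ∀ z : ℂ, ‖z‖ ≠ 1 → T z = R z) :
    HasReflectionSum T c := by
  intro z hz hz0
  rw [hTR z hz, hTR _ (by simpa [norm_circleReflection] using hz), hR z hz hz0]

open Classical in
/-- The extension of `L` from the closed disc by the reflection `z ↦ c - L(1/z̄)*`. -/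
noncomputable def reflectionExtension (L : ℂ → E) (c : E) (z : ℂ) : E :=
  if ‖z‖ ≤ 1 then L z else c - star (L (circleReflection z))

theorem HasReflectionSum.reflectionExtension_eq (hR : HasReflectionSum R c)
    (hLR : EqOn L R unitDisc) {z : ℂ} (hz : ‖z‖ ≠ 1) : reflectionExtension L c z = R z := by
  rcases hz.lt_or_gt with hz1 | hz1
  · rw [reflectionExtension, if_pos hz1.le, hLR hz1]
  · have hz0 : z ≠ 0 := norm_pos_iff.1 (one_pos.trans hz1)
    have hrefl : circleReflection z ∈ unitDisc := by
      simpa only [mem_ofPred_eq, norm_circleReflection] using inv_lt_one_of_one_lt₀ hz1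
    rw [reflectionExtension, if_neg hz1.not_ge, hLR hrefl, sub_eq_iff_eq_add, hR z hz hz0]

variable [ContinuousStar E]

theorem HasReflectionSum.add_star_eq_of_continuousAt (hR : HasReflectionSum R c) {z : ℂ}
    (hz : ‖z‖ = 1) (hc : ContinuousAt R z) : R z + star (R z) = c := by
  have hz0 : z ≠ 0 := norm_ne_zero_iff.1 (hz ▸ one_ne_zero)
  have hsum : ContinuousAt (fun w => R w + star (R (circleReflection w))) z :=
    hc.add (ContinuousAt.comp (by rwa [circleReflection_eq_self hz])
      (continuousAt_circleReflection hz0)).star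
  have hlim : Tendsto (fun w => R w + star (R (circleReflection w))) (𝓝[unitDisc] z)
      (𝓝 (R z + star (R z))) := by
    simpa only [circleReflection_eq_self hz] using hsum.tendsto.mono_left nhdsWithin_le_nhds
  have := nhdsWithin_unitDisc_neBot hz
  refine tendsto_nhds_unique_of_eventuallyEq hlim tendsto_const_nhds ?_
  filter_upwards [self_mem_nhdsWithin, nhdsWithin_le_nhds (isOpen_ne.mem_nhds hz0)] with w hw hw0
  exact hR w (ne_of_lt hw) hw0

theorem continuousOn_reflectionExtension {Δ : Set ℂ} (hΔ : Δ ⊆ sphere 0 1)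
    (hL : ContinuousOn L (unitDisc ∪ Δ)) (hsum : ∀ z ∈ Δ, L z + star (L z) = c) :
    ContinuousOn (reflectionExtension L c) (unitDisc ∪ unitDiscExterior ∪ Δ) := by
  have norm_eq_one {z : ℂ} (hz : z ∈ Δ) : ‖z‖ = 1 := mem_sphere_zero_iff_norm.1 (hΔ hz)
  have hin : (unitDisc ∪ unitDiscExterior ∪ Δ) ∩ closure {z | ‖z‖ ≤ 1} ⊆ unitDisc ∪ Δ := by
    rw [(isClosed_le continuous_norm continuous_const).closure_eq]
    rintro z ⟨(hz | (hz : 1 < ‖z‖)) | hz, (hz1 : ‖z‖ ≤ 1)⟩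
    exacts [Or.inl hz, absurd hz1 hz.not_ge, Or.inr hz]
  have hout : (unitDisc ∪ unitDiscExterior ∪ Δ) ∩ closure {z | ¬‖z‖ ≤ 1} ⊆
      unitDiscExterior ∪ Δ := by
    simp only [not_le]
    rintro z ⟨((hz : ‖z‖ < 1) | hz) | hz, hz1⟩
    exacts [absurd (closure_lt_subset_le continuous_const continuous_norm hz1) hz.not_ge,
      Or.inl hz, Or.inr hz]
  have hmaps : MapsTo circleReflection (unitDiscExterior ∪ Δ) (unitDisc ∪ Δ) := by
    rintro z (hz | hz)
    · left
      simpa only [mem_ofPred_eq, norm_circleReflection] using inv_lt_one_of_one_lt₀ hz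
    · right
      rwa [circleReflection_eq_self (norm_eq_one hz)]
  have hrefl : ContinuousOn circleReflection (unitDiscExterior ∪ Δ) := by
    refine fun z hz => (continuousAt_circleReflection ?_).continuousWithinAt
    rintro rfl
    rcases hz with hz | hz
    · exact absurd hz (by simp)
    · simpa using norm_eq_one hz
  refine ContinuousOn.if ?_ (hL.mono hin)
    ((continuousOn_const.sub (hL.comp hrefl hmaps).star).mono hout)
  rintro z ⟨(hz | hz) | hz, hfr⟩
  · exact absurd (frontier_le_subset_eq continuous_norm continuous_const hfr) (ne_of_lt hz)
  · exact absurd (frontier_le_subset_eq continuous_norm continuous_const hfr) (ne_of_gt hz)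
  · rw [circleReflection_eq_self (norm_eq_one hz), ← hsum z hz, add_sub_cancel_right]

theorem HasReflectionSum.hasAnalyticContinuation [NormedSpace ℂ E] [CompleteSpace E]
    (hR : HasReflectionSum R c) (hd : ∀ z : ℂ, ‖z‖ ≠ 1 → DifferentiableAt ℂ R z)
    {O : Set ℂ} (hO : IsOpen O) (hL : ContinuousOn L (unitDisc ∪ O ∩ sphere 0 1))
    (hLR : EqOn L R unitDisc)
    (hsum : ∀ z ∈ O ∩ sphere 0 1, L z + star (L z) = c) :
    HasAnalyticContinuation R (O ∩ sphere 0 1) := by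
  have hext (z : ℂ) (hz : ‖z‖ ≠ 1) : reflectionExtension L c z = R z :=
    hR.reflectionExtension_eq hLR hz
  refine ⟨reflectionExtension L c, analyticOnNhd_of_differentiableAt_of_norm_ne_one
    (isOpen_disc_union_exterior_union_inter_sphere hO)
    (continuousOn_reflectionExtension inter_subset_right hL hsum) fun z _ hz => ?_, hext⟩
  refine (hd z hz).congr_of_eventuallyEq ?_
  filter_upwards [(isOpen_ne_fun continuous_norm continuous_const).mem_nhds hz] with w hw
  exact hext w hw

end Reflection

section StarRing

variable {A : Type*} [Ring A] [StarRing A]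

theorem one_sub_inverse_mem_unitary_iff {t : A} (ht : IsUnit t) :
    1 - Ring.inverse t ∈ unitary A ↔ t + star t = 1 := by
  obtain ⟨t, rfl⟩ := ht
  rw [Ring.inverse_unit]
  set w : A := 1 - ↑t⁻¹
  have hstar : IsUnit (star (t : A)) := t.isUnit.star
  have hleft : star (t : A) * (star w * w - 1) * t = 1 - (t + star (t : A)) := by
    have : star (t : A) * star (↑t⁻¹ : A) = 1 := by rw [← star_mul, t.inv_mul, star_one]
    simp only [w, star_sub, star_one, mul_sub, sub_mul, mul_one, one_mul, this, mul_assoc,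
      t.inv_mul, ← mul_assoc (star (t : A)) (star _)]
    abel
  have hright : (t : A) * (w * star w - 1) * star (t : A) = 1 - (t + star (t : A)) := by
    have : star (↑t⁻¹ : A) * star (t : A) = 1 := by rw [← star_mul, t.mul_inv, star_one]
    simp only [w, star_sub, star_one, mul_sub, sub_mul, mul_one, one_mul, this, mul_assoc,
      Units.mul_inv_cancel_left]
    abel
  have hisom : star w * w = 1 ↔ t + star (t : A) = 1 := by
    rw [← sub_eq_zero, ← hstar.mul_right_eq_zero, ← t.isUnit.mul_left_eq_zero, hleft, sub_eq_zero,
      eq_comm]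
  have hcoisom : w * star w = 1 ↔ t + star (t : A) = 1 := by
    rw [← sub_eq_zero, ← t.isUnit.mul_right_eq_zero, ← hstar.mul_left_eq_zero, hright, sub_eq_zero,
      eq_comm]
  rw [Unitary.mem_iff, hisom, hcoisom, and_self]

theorem smul_mem_unitary_iff [Algebra ℂ A] [StarModule ℂ A] {z : ℂ} (hz : ‖z‖ = 1) {w : A} :
    z • w ∈ unitary A ↔ w ∈ unitary A := by
  simp [Unitary.mem_iff, smul_smul, conj_mul', mul_conj', hz]

end StarRing

section CStarAlgebra

variable {A : Type*} [CStarAlgebra A]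

theorem isUnit_of_add_star_eq_one {t : A} (h : t + star t = 1) : IsUnit t := by
  have hstar : star t = 1 - t := eq_sub_of_add_eq' h
  have hself : IsSelfAdjoint (I • ((2 : ℂ) • t - 1)) := by
    rw [IsSelfAdjoint, star_smul, star_sub, star_smul, hstar]
    simp only [star_one, RCLike.star_def, conj_I, map_ofNat]
    module
  have hspec : -I ∉ spectrum ℂ (I • ((2 : ℂ) • t - 1)) := fun hmem => by
    simpa using hself.im_eq_zero_of_mem_spectrum hmem
  have hshift : algebraMap ℂ A (-I) - I • ((2 : ℂ) • t - 1) = Units.mk0 (-2 * I) (by simp) • t := by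
    rw [Algebra.algebraMap_eq_smul_one, Units.smul_mk0]
    module
  rwa [spectrum.notMem_iff, hshift, isUnit_smul_iff] at hspec

theorem isUnit_one_sub_smul_of_mem_unitary {u : A} (hu : u ∈ unitary A) {z : ℂ} (hz : ‖z‖ ≠ 1) :
    IsUnit (1 - z • u) := by
  rcases eq_or_ne z 0 with rfl | hz0
  · simp
  have hspec : z⁻¹ ∉ spectrum ℂ u := fun hmem => hz (by
    simpa using spectrum.norm_eq_one_of_unitary hu hmem)
  have hscale : 1 - z • u = Units.mk0 z hz0 • (algebraMap ℂ A z⁻¹ - u) := by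
    rw [Algebra.algebraMap_eq_smul_one, Units.smul_mk0, smul_sub, smul_inv_smul₀ hz0]
  rw [hscale, isUnit_smul_iff]
  exact spectrum.notMem_iff.1 hspec

theorem hasReflectionSum_inverse_one_sub_smul {u : A} (hu : u ∈ unitary A) :
    HasReflectionSum (fun z => Ring.inverse (1 - z • u)) 1 := by
  intro z hz hz0
  have hunit : IsUnit (1 - z • u) := isUnit_one_sub_smul_of_mem_unitary hu hz
  have hunit' : IsUnit (1 - (star z)⁻¹ • u) :=
    isUnit_one_sub_smul_of_mem_unitary hu (by simpa using hz)
  have hfactor : star (1 - (star z)⁻¹ • u) = -(z⁻¹ • star u) * (1 - z • u) := by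
    simp only [star_sub, star_one, star_smul, star_inv₀, star_star, mul_sub, mul_one, neg_mul,
      smul_mul_smul_comm, Unitary.star_mul_self_of_mem hu, inv_mul_cancel₀ hz0, one_smul]
    abel
  rw [circleReflection, ← Ring.inverse_star, ← eq_sub_iff_add_eq', ← hunit'.star.mul_right_inj,
    Ring.mul_inverse_cancel _ hunit'.star, hfactor, mul_sub, mul_one, mul_assoc,
    Ring.mul_inverse_cancel _ hunit]
  simp [mul_sub, smul_smul, hz0, Unitary.star_mul_self_of_mem hu]

end CStarAlgebra

section ResolventSymbol

variable {A : Type*} [Ring A] [Module ℂ A]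

/-- The operator `w` for which `t = (1 - z w)⁻¹`, given `z ≠ 0` and an invertible `t`. -/
noncomputable def resolventSymbol (z : ℂ) (t : A) : A :=
  z⁻¹ • (1 - Ring.inverse t)

theorem one_sub_smul_resolventSymbol {z : ℂ} (hz : z ≠ 0) (t : A) :
    1 - z • resolventSymbol z t = Ring.inverse t := by
  rw [resolventSymbol, smul_inv_smul₀ hz, sub_sub_cancel]

theorem resolventSymbol_inverse_one_sub_smul {z : ℂ} (hz : z ≠ 0) {w : A}
    (hw : IsUnit (1 - z • w)) : resolventSymbol z (Ring.inverse (1 - z • w)) = w := by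
  rw [resolventSymbol, Ring.inverse_inverse hw, sub_sub_cancel, inv_smul_smul₀ hz]

theorem resolventSymbol_mem_unitary_iff {A : Type*} [Ring A] [StarRing A] [Algebra ℂ A]
    [StarModule ℂ A] {z : ℂ} (hz : ‖z‖ = 1) {t : A} (ht : IsUnit t) :
    resolventSymbol z t ∈ unitary A ↔ t + star t = 1 := by
  rw [resolventSymbol, smul_mem_unitary_iff (by rw [norm_inv, hz, inv_one]),
    one_sub_inverse_mem_unitary_iff ht]

theorem continuousAt_resolventSymbol {A : Type*} [NormedRing A] [NormedAlgebra ℂ A]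
    [CompleteSpace A] {T : ℂ → A} {z : ℂ} (hz : z ≠ 0) (hT : ContinuousAt T z)
    (hu : IsUnit (T z)) : ContinuousAt (fun w => resolventSymbol w (T w)) z := by
  have hinv : ContinuousAt (fun w => Ring.inverse (T w)) z :=
    (differentiableAt_inverse (𝕜 := ℂ) hu).continuousAt.comp hT
  exact (continuousAt_id.inv₀ hz).smul (continuousAt_const.sub hinv)

end ResolventSymbol

section Hilbert

variable {H : Type*} [NormedAddCommGroup H] [InnerProductSpace ℂ H]

theorem ClosedIsometricOperator.norm_sq_op_add (V : ClosedIsometricOperator H) (x : V.op.domain)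
    (y : V.defectInfty) : ‖V.op x + y‖ ^ 2 = ‖x‖ ^ 2 + ‖y‖ ^ 2 := by
  have horth : inner ℂ (V.op x) (y : H) = 0 :=
    Submodule.inner_right_of_mem_orthogonal (LinearMap.mem_range_self V.op.toFun x) y.2
  simpa only [← sq, V.norm_map, Submodule.coe_norm] using
    norm_add_sq_eq_norm_sq_add_norm_sq_of_inner_eq_zero _ _ horth

variable [CompleteSpace H]

theorem mem_unitary_iff_isometry_and_surjective {W : H →L[ℂ] H} :
    W ∈ unitary (H →L[ℂ] H) ↔ Isometry W ∧ Function.Surjective W := by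
  constructor
  · intro hW
    exact ⟨W.isometry_iff_adjoint_comp_self.2 hW.1,
      fun y => ⟨star W y, congrArg (fun B : H →L[ℂ] H => B y) hW.2⟩⟩
  · rintro ⟨hisom, hsurj⟩
    have hunit : IsUnit W := ContinuousLinearMap.isUnit_iff_bijective.2 ⟨hisom.injective, hsurj⟩
    exact hunit.mem_unitary_iff_star_mul_self.2 (W.isometry_iff_adjoint_comp_self.1 hisom)

namespace ClosedIsometricOperator

variable (V : ClosedIsometricOperator H)

theorem continuous_oplus : Continuous V.oplus := by
  unfold oplus
  fun_prop

theorem exists_eq_domain_add_defectZero (h : H) :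
    ∃ (x : V.op.domain) (y : V.defectZero), h = x + y :=
  ⟨_, _, (V.op.domain.starProjection_add_starProjection_orthogonal h).symm⟩

theorem exists_eq_op_add_defectInfty (h : H) :
    ∃ (x : V.op.domain) (y : V.defectInfty), h = V.op x + y := by
  have hclosed : IsClosed (LinearMap.range V.op.toFun : Set H) :=
    V.isom.isometry.isClosedEmbedding.isClosed_range
  have := hclosed.completeSpace_coe
  obtain ⟨x, hx⟩ := ((LinearMap.range V.op.toFun).orthogonalProjectionOnto h).2
  refine ⟨x, V.defectInfty.orthogonalProjectionOnto h, ?_⟩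
  rw [show V.op x = _ from hx]
  exact ((LinearMap.range V.op.toFun).starProjection_add_starProjection_orthogonal h).symm

variable {V} (C : V.defectZero →L[ℂ] V.defectInfty)

theorem oplus_domain_add_defectZero (x : V.op.domain) (y : V.defectZero) :
    V.oplus C (x + y) = V.op x + C y := by
  have hx : V.op.domain.orthogonalProjectionOnto (x + y : H) = x := by
    rw [map_add, Submodule.orthogonalProjectionOnto_mem_subspace_eq_self,
      Submodule.orthogonalProjectionOnto_apply_of_mem_orthogonal y.2, add_zero]
  have hy : V.defectZero.orthogonalProjectionOnto (x + y : H) = y := by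
    rw [map_add, Submodule.orthogonalProjectionOnto_orthogonal_apply_eq_zero x.2,
      Submodule.orthogonalProjectionOnto_mem_subspace_eq_self, zero_add]
  change V.op (V.op.domain.orthogonalProjectionOnto (x + y : H)) +
    (C (V.defectZero.orthogonalProjectionOnto (x + y : H)) : H) = V.op x + C y
  rw [hx, hy]

theorem oplus_coe_defectZero (y : V.defectZero) : V.oplus C y = C y := by
  simpa using oplus_domain_add_defectZero C 0 y

theorem isometry_oplus_iff : Isometry (V.oplus C) ↔ Isometry C := by
  simp only [AddMonoidHomClass.isometry_iff_norm]
  constructor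
  · intro hC y
    simpa only [oplus_coe_defectZero, Submodule.coe_norm] using hC y
  · intro hC h
    obtain ⟨x, y, rfl⟩ := V.exists_eq_domain_add_defectZero h
    have hxy : inner ℂ (x : H) (y : H) = 0 := Submodule.inner_right_of_mem_orthogonal x.2 y.2
    rw [← sq_eq_sq₀ (norm_nonneg _) (norm_nonneg _), oplus_domain_add_defectZero, norm_sq_op_add,
      hC, sq ‖(x : H) + y‖, norm_add_sq_eq_norm_sq_add_norm_sq_of_inner_eq_zero _ _ hxy]
    simp [sq]

theorem surjective_oplus_iff : Function.Surjective (V.oplus C) ↔ Function.Surjective C := by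
  constructor
  · intro hC w
    obtain ⟨h, hh⟩ := hC w
    obtain ⟨x, y, rfl⟩ := V.exists_eq_domain_add_defectZero h
    refine ⟨y, sub_eq_zero.1 (norm_eq_zero.1 ?_)⟩
    have hsum : V.op x + ((C y - w : V.defectInfty) : H) = 0 := by
      rw [Submodule.coe_sub, ← add_sub_assoc, ← oplus_domain_add_defectZero, hh, sub_self]
    have hnorm := V.norm_sq_op_add x (C y - w)
    rw [hsum, norm_zero] at hnorm
    nlinarith [sq_nonneg ‖x‖, sq_nonneg ‖C y - w‖]
  · intro hC h
    obtain ⟨x, w, rfl⟩ := V.exists_eq_op_add_defectInfty h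
    obtain ⟨y, rfl⟩ := hC w
    exact ⟨x + y, oplus_domain_add_defectZero C x y⟩

theorem oplus_mem_unitary_iff :
    V.oplus C ∈ unitary (H →L[ℂ] H) ↔ Isometry C ∧ Function.Surjective C := by
  rw [mem_unitary_iff_isometry_and_surjective, isometry_oplus_iff, surjective_oplus_iff]

variable (V)

/-- The block `N_0 → N_∞` of a bounded operator, with respect to the orthogonal decompositions
`H = D(V) ⊕ N_0` and `H = R(V) ⊕ N_∞`; it recovers `C` from `V ⊕ C`. -/
noncomputable def corner (W : H →L[ℂ] H) : V.defectZero →L[ℂ] V.defectInfty :=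
  V.defectInfty.orthogonalProjectionOnto ∘L W ∘L V.defectZero.subtypeL

theorem continuous_corner : Continuous V.corner := by
  unfold corner
  fun_prop

variable {V} in
theorem corner_oplus : V.corner (V.oplus C) = C := by
  ext y
  simp [corner, oplus_coe_defectZero]

end ClosedIsometricOperator

section GeneralizedResolvent

variable {K : Type*} [NormedAddCommGroup K] [InnerProductSpace ℂ K] [CompleteSpace K]
  (ι : H →ₗᵢ[ℂ] K) (U : K ≃ₗᵢ[ℂ] K)

theorem toContinuousLinearMap_mem_unitary :
    (U.toContinuousLinearEquiv : K →L[ℂ] K) ∈ unitary (K →L[ℂ] K) :=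
  (Unitary.linearIsometryEquiv.symm U).2

theorem differentiableAt_generalizedResolvent {z : ℂ} (hz : ‖z‖ ≠ 1) :
    DifferentiableAt ℂ (generalizedResolvent ι U) z := by
  have hinv : DifferentiableAt ℂ (fun z : ℂ => Ring.inverse
      (1 - z • (U.toContinuousLinearEquiv : K →L[ℂ] K))) z :=
    DifferentiableAt.inverse (by fun_prop)
      (isUnit_one_sub_smul_of_mem_unitary (toContinuousLinearMap_mem_unitary U) hz)
  unfold generalizedResolvent
  fun_prop

theorem hasReflectionSum_generalizedResolvent :
    HasReflectionSum (generalizedResolvent ι U) 1 := by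
  intro z hz hz0
  have hsum := hasReflectionSum_inverse_one_sub_smul (toContinuousLinearMap_mem_unitary U) z hz hz0
  rw [← eq_sub_iff_add_eq', ContinuousLinearMap.star_eq_adjoint] at hsum ⊢
  simp only [generalizedResolvent, ContinuousLinearMap.adjoint_comp,
    ContinuousLinearMap.adjoint_adjoint, hsum]
  ext x
  have hι : ContinuousLinearMap.adjoint ι.toContinuousLinearMap (ι x) = x :=
    congrArg (fun B : H →L[ℂ] H => B x) ι.adjoint_comp_self
  simp [hι]

end GeneralizedResolvent

section Chumakin

variable {V : ClosedIsometricOperator H} {F G : ℂ → V.defectZero →L[ℂ] V.defectInfty}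
  {R T : ℂ → H →L[ℂ] H} {z : ℂ}

theorem IsChumakinParameter.isUnit_one_sub (hF : IsChumakinParameter V R F) (hz : ‖z‖ < 1) :
    IsUnit (1 - z • V.oplus (F z)) :=
  ⟨⟨_, R z, hF.eq_one_mul z hz, hF.mul_eq_one z hz⟩, rfl⟩

theorem IsChumakinParameter.inverse_one_sub (hF : IsChumakinParameter V R F) (hz : ‖z‖ < 1) :
    Ring.inverse (1 - z • V.oplus (F z)) = R z :=
  Ring.inverse_unit ⟨_, R z, hF.eq_one_mul z hz, hF.mul_eq_one z hz⟩

theorem IsChumakinParameter.resolventSymbol_eq_oplus (hF : IsChumakinParameter V R F)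
    (hz : ‖z‖ < 1) (hz0 : z ≠ 0) : resolventSymbol z (R z) = V.oplus (F z) := by
  rw [← hF.inverse_one_sub hz, resolventSymbol_inverse_one_sub_smul hz0 (hF.isUnit_one_sub hz)]

theorem IsChumakinParameter.oplus_corner_resolventSymbol (hF : IsChumakinParameter V R F)
    (hTR : EqOn T R unitDisc) (hz : ‖z‖ = 1) (hT : ContinuousAt T z) (hu : IsUnit (T z)) :
    V.oplus (V.corner (resolventSymbol z (T z))) = resolventSymbol z (T z) := by
  have hz0 : z ≠ 0 := norm_ne_zero_iff.1 (hz ▸ one_ne_zero)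
  have hclosed : IsClosed {W : H →L[ℂ] H | V.oplus (V.corner W) = W} :=
    isClosed_eq (V.continuous_oplus.comp V.continuous_corner) continuous_id
  have hlim : Tendsto (fun w => resolventSymbol w (T w)) (𝓝[unitDisc] z)
      (𝓝 (resolventSymbol z (T z))) :=
    (continuousAt_resolventSymbol hz0 hT hu).tendsto.mono_left nhdsWithin_le_nhds
  have := nhdsWithin_unitDisc_neBot hz
  refine hclosed.mem_of_tendsto hlim ?_
  filter_upwards [self_mem_nhdsWithin, nhdsWithin_le_nhds (isOpen_ne.mem_nhds hz0)] with w hw hw0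
  simp only [hTR hw, hF.resolventSymbol_eq_oplus hw hw0,
    ClosedIsometricOperator.corner_oplus]

/-- The extension of the Chumakin parameter `F` read off an extension `T` of the resolvent function
by inverting Chumakin's formula. The formula says nothing at `0`, where the value is taken from
`F`. -/
noncomputable def parameterExtension (F : ℂ → V.defectZero →L[ℂ] V.defectInfty)
    (T : ℂ → H →L[ℂ] H) : ℂ → V.defectZero →L[ℂ] V.defectInfty :=
  Function.update (fun z => V.corner (resolventSymbol z (T z))) 0 (F 0)

theorem IsChumakinParameter.eqOn_parameterExtension (hF : IsChumakinParameter V R F)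
    (hTR : EqOn T R unitDisc) : EqOn (parameterExtension F T) F unitDisc := by
  intro z hz
  rcases eq_or_ne z 0 with rfl | hz0
  · exact Function.update_self ..
  · rw [parameterExtension, Function.update_of_ne hz0, hTR hz, hF.resolventSymbol_eq_oplus hz hz0,
      ClosedIsometricOperator.corner_oplus]

theorem IsChumakinParameter.continuousOn_parameterExtension (hF : IsChumakinParameter V R F)
    (hTR : EqOn T R unitDisc) {Δ : Set ℂ} (hΔ : Δ ⊆ sphere 0 1)
    (hT : ∀ z ∈ Δ, ContinuousAt T z) (hu : ∀ z ∈ Δ, IsUnit (T z)) :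
    ContinuousOn (parameterExtension F T) (unitDisc ∪ Δ) := by
  rintro z (hz | hz) <;> refine ContinuousAt.continuousWithinAt ?_
  · exact (hF.schur.analytic z hz).continuousAt.congr
      ((hF.eqOn_parameterExtension hTR).symm.eventuallyEq_of_mem (isOpen_unitDisc.mem_nhds hz))
  · have hz0 : z ≠ 0 := ne_of_mem_sphere (hΔ hz) one_ne_zero
    exact (continuousAt_update_of_ne hz0).2
      (V.continuous_corner.continuousAt.comp (continuousAt_resolventSymbol hz0 (hT z hz) (hu z hz)))

theorem IsChumakinParameter.oplus_parameterExtension (hF : IsChumakinParameter V R F)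
    (hTR : EqOn T R unitDisc) (hz : ‖z‖ = 1) (hT : ContinuousAt T z) (hu : IsUnit (T z)) :
    V.oplus (parameterExtension F T z) = resolventSymbol z (T z) := by
  have hz0 : z ≠ 0 := norm_ne_zero_iff.1 (hz ▸ one_ne_zero)
  rw [parameterExtension, Function.update_of_ne hz0, hF.oplus_corner_resolventSymbol hTR hz hT hu]

theorem inverse_one_sub_smul_oplus_add_star_eq_one_iff {C : V.defectZero →L[ℂ] V.defectInfty}
    (hz : ‖z‖ = 1) (hC : IsUnit (1 - z • V.oplus C)) :
    Ring.inverse (1 - z • V.oplus C) + star (Ring.inverse (1 - z • V.oplus C)) = 1 ↔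
      Isometry C ∧ Function.Surjective C := by
  have hz0 : z ≠ 0 := norm_ne_zero_iff.1 (hz ▸ one_ne_zero)
  rw [← resolventSymbol_mem_unitary_iff hz hC.ringInverse,
    resolventSymbol_inverse_one_sub_smul hz0 hC, ClosedIsometricOperator.oplus_mem_unitary_iff]

theorem IsChumakinParameter.isometry_surjective_bijective_of_add_star_eq_one
    (hF : IsChumakinParameter V R F) (hTR : EqOn T R unitDisc) (hz : ‖z‖ = 1)
    (hT : ContinuousAt T z) (hsum : T z + star (T z) = 1) :
    (Isometry (parameterExtension F T z) ∧ Function.Surjective (parameterExtension F T z)) ∧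
      Function.Bijective (1 - z • V.oplus (parameterExtension F T z) : H →L[ℂ] H) := by
  have hu : IsUnit (T z) := isUnit_of_add_star_eq_one hsum
  have hz0 : z ≠ 0 := norm_ne_zero_iff.1 (hz ▸ one_ne_zero)
  have hinv : 1 - z • V.oplus (parameterExtension F T z) = Ring.inverse (T z) := by
    rw [hF.oplus_parameterExtension hTR hz hT hu, one_sub_smul_resolventSymbol hz0]
  have hunit : IsUnit (1 - z • V.oplus (parameterExtension F T z)) := hinv ▸ hu.ringInverse
  refine ⟨(inverse_one_sub_smul_oplus_add_star_eq_one_iff hz hunit).1 ?_,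
    ContinuousLinearMap.isUnit_iff_bijective.1 hunit⟩
  rwa [hinv, Ring.inverse_inverse hu]

theorem IsChumakinParameter.continuousOn_inverse_one_sub (hF : IsChumakinParameter V R F)
    (hGF : EqOn G F unitDisc) {Δ : Set ℂ} (hG : ContinuousOn G (unitDisc ∪ Δ))
    (hbij : ∀ z ∈ Δ, Function.Bijective (1 - z • V.oplus (G z) : H →L[ℂ] H)) :
    ContinuousOn (fun z => Ring.inverse (1 - z • V.oplus (G z))) (unitDisc ∪ Δ) := by
  intro z hz
  have hunit : IsUnit (1 - z • V.oplus (G z)) := by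
    rcases hz with hz | hz
    · rw [hGF hz]
      exact hF.isUnit_one_sub hz
    · exact ContinuousLinearMap.isUnit_iff_bijective.2 (hbij z hz)
  have hcont : ContinuousWithinAt (fun w : ℂ => 1 - w • V.oplus (G w)) (unitDisc ∪ Δ) z :=
    continuousWithinAt_const.sub (continuousWithinAt_id.smul
      (V.continuous_oplus.continuousAt.comp_continuousWithinAt (hG z hz)))
  exact (differentiableAt_inverse (𝕜 := ℂ) hunit).continuousAt.comp_continuousWithinAt
    (f := fun w : ℂ => 1 - w • V.oplus (G w)) hcont

end Chumakin

end Hilbert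

end IsometricGaps

open IsometricGaps Set Metric in
theorem corollary3p1_general
    {H : Type*} [NormedAddCommGroup H] [InnerProductSpace ℂ H] [CompleteSpace H]
    (V : ClosedIsometricOperator H)
    {K : Type*} [NormedAddCommGroup K] [InnerProductSpace ℂ K] [CompleteSpace K]
    (ι : H →ₗᵢ[ℂ] K) (U : K ≃ₗᵢ[ℂ] K) (F : ℂ → V.defectZero →L[ℂ] V.defectInfty)
    (hF : IsChumakinParameter V (generalizedResolvent ι U) F)
    (O : Set ℂ) (hO : IsOpen O) :
    HasAnalyticContinuation (generalizedResolvent ι U) (O ∩ sphere 0 1) ↔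
      ∃ G : ℂ → V.defectZero →L[ℂ] V.defectInfty,
        EqOn G F {z : ℂ | ‖z‖ < 1} ∧
        ContinuousOn G ({z : ℂ | ‖z‖ < 1} ∪ O ∩ sphere 0 1) ∧
        (∀ z ∈ O ∩ sphere 0 1, Isometry (G z) ∧ Function.Surjective (G z)) ∧
        (∀ z ∈ O ∩ sphere 0 1, Function.Bijective (1 - z • V.oplus (G z) : H →L[ℂ] H)) := by
  have hsymm := hasReflectionSum_generalizedResolvent ι U
  have norm_eq_one {z : ℂ} (hz : z ∈ O ∩ sphere 0 1) : ‖z‖ = 1 :=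
    mem_sphere_zero_iff_norm.1 hz.2
  constructor
  · rintro ⟨T, hT, hTR⟩
    have hTR' : EqOn T _ unitDisc := fun z hz => hTR z (ne_of_lt hz)
    have hcont (z) (hz : z ∈ O ∩ sphere 0 1) : ContinuousAt T z :=
      (hT z (Or.inr hz)).continuousAt
    have hsum (z) (hz : z ∈ O ∩ sphere 0 1) : T z + star (T z) = 1 :=
      (hsymm.congr hTR).add_star_eq_of_continuousAt (norm_eq_one hz) (hcont z hz)
    have hboundary (z) (hz : z ∈ O ∩ sphere 0 1) :=
      hF.isometry_surjective_bijective_of_add_star_eq_one hTR' (norm_eq_one hz) (hcont z hz)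
        (hsum z hz)
    exact ⟨parameterExtension F T, hF.eqOn_parameterExtension hTR',
      hF.continuousOn_parameterExtension hTR' inter_subset_right hcont fun z hz =>
        isUnit_of_add_star_eq_one (hsum z hz),
      fun z hz => (hboundary z hz).1, fun z hz => (hboundary z hz).2⟩
  · rintro ⟨G, hGF, hG, hisom, hbij⟩
    refine hsymm.hasAnalyticContinuation
      (fun z => differentiableAt_generalizedResolvent ι U) hO
      (hF.continuousOn_inverse_one_sub hGF hG hbij) (fun z hz => ?_) fun z hz => ?_
    · simp only [hGF hz, hF.inverse_one_sub hz]
    · exact (inverse_one_sub_smul_oplus_add_star_eq_one_iff (norm_eq_one hz)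
        (ContinuousLinearMap.isUnit_iff_bijective.2 (hbij z hz))).2 (hisom z hz)

theorem corollary3p1
    {H : Type*} [NormedAddCommGroup H] [InnerProductSpace ℂ H] [CompleteSpace H]
    (V : IsometricGaps.ClosedIsometricOperator H)
    {K : Type*} [NormedAddCommGroup K] [InnerProductSpace ℂ K] [CompleteSpace K]
    (ι : H →ₗᵢ[ℂ] K) (U : K ≃ₗᵢ[ℂ] K) (hU : IsometricGaps.IsUnitaryExtension V ι U)
    (F : ℂ → V.defectZero →L[ℂ] V.defectInfty)
    (hF : IsometricGaps.IsChumakinParameter V (IsometricGaps.generalizedResolvent ι U) F)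
    (Δ : Set ℂ) (hΔ : IsometricGaps.IsOpenArc Δ) :
    IsometricGaps.HasAnalyticContinuation (IsometricGaps.generalizedResolvent ι U) Δ ↔
      ∃ G : ℂ → V.defectZero →L[ℂ] V.defectInfty,
        Set.EqOn G F {z : ℂ | ‖z‖ < 1} ∧
        ContinuousOn G ({z : ℂ | ‖z‖ < 1} ∪ Δ) ∧
        (∀ z ∈ Δ, Isometry (G z) ∧ Function.Surjective (G z)) ∧
        (∀ z ∈ Δ, Function.Bijective (1 - z • V.oplus (G z) : H →L[ℂ] H)) := by
  obtain ⟨O, hO, rfl⟩ := hΔ.exists_isOpen_inter_sphere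
  exact corollary3p1_general V ι U F hF O hO
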